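/- Let $q=2^r$ with $r\ge 1$, let $\mathbb F_q$ be the field with $q$ elements, and let $tr(x)=x+x^2+x^{2^2}+\cdots+x^{2^{r-1}}$ be the trace function $\mathbb F_q\to\mathbb F_2$. For $n\ge 1$ let $$P^+(2n,q)=\left\{\begin{bmatrix}A&0\\0&{}^tA^{-1}\end{bmatrix}\begin{bmatrix}1_n&B\\0&1_n\end{bmatrix}\;:\;A\in GL(n,q),\ B\ \text{an alternating } n\times n \text{ matrix over } \mathbb F_q\right\}$$ (a matrix is alternating if it is skew-symmetric with zero diagonal), and for $0\le s\le n$ let $$\sigma_s^+=\begin{bmatrix}0&0&1_s&0\\0&1_{n-s}&0&0\\1_s&0&0&0\\0&0&0&1_{n-s}\end{bmatrix}.$$ Put $DC_1^{\pm}(n,q)=P^+(2n,q)\,\sigma_{n-1}^+\,P^+(2n,q)$ and $DC_2^{\pm}(n,q)=P^+(2n,q)\,\sigma_{n-2}^+\,P^+(2n,q)$ (the latter for $n\ge 2$), where the superscript is $+$ if $n$ is even and $-$ if $n$ is odd. For a set $S$ of matrices and $\beta\in\mathbb F_q$ let $N_S(\beta)$ be the number of $w\in S$ whose matrix trace is $\beta$.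 Then: (a) For all even $n\ge 2$ and all $q$, $N_{DC_1^+(n,q)}(\beta)>0$ for all $\beta\in\mathbb F_q$. (b) For all even $n\ge 4$ and all $q$, and for $n=2$ and all $q\ge 4$, $N_{DC_2^+(n,q)}(\beta)>0$ for all $\beta\in\mathbb F_q$. For $n=2$ and $q=2$, $N_{DC_2^+(2,2)}(1)=0$ and $N_{DC_2^+(2,2)}(0)=12=|P^+(4,2)|$. (c) For all odd $n\ge 3$ and all $q$, $N_{DC_1^-(n,q)}(\beta)>0$ for all $\beta\in\mathbb F_q$. For $n=1$ and all $q$, $$N_{DC_1^-(1,q)}(\beta)=\begin{cases}1,&\beta=0,\\2,&\beta\ne 0,\ tr(\beta^{-1})=0,\\0,&\beta\neq 0,\ tr(\beta^{-1})=1.\end{cases}$$ (d) For all odd $n\ge 3$ and all $q$, $N_{DC_2^-(n,q)}(\beta)>0$ for all $\beta\in\mathbb F_q$. -/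

import Mathlib

namespace OrthogonalDoubleCoset

open Matrix

/-- A square matrix is alternating if its diagonal vanishes and `a j i = - a i j` for all `i, j`. -/
def IsAlternating {n : ℕ} {F : Type*} [Field F] (B : Matrix (Fin n) (Fin n) F) : Prop :=
  (∀ i, B i i = 0) ∧ ∀ i j, B i j = -B j i

/-- The maximal parabolic subgroup `P⁺(2n, q)` of the orthogonal group `O⁺(2n, q)`, as a set of
`2n × 2n` matrices written in `n × n` blocks: all products
`[A, 0; 0, ᵗA⁻¹] * [1, B; 0, 1]` with `A ∈ GL(n, q)` and `B` alternating. -/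
def parabolic (n : ℕ) (F : Type*) [Field F] : Set (Matrix (Fin n ⊕ Fin n) (Fin n ⊕ Fin n) F) :=
  {w | ∃ (A : GL (Fin n) F) (B : Matrix (Fin n) (Fin n) F), IsAlternating B ∧
    w = fromBlocks (A : Matrix (Fin n) (Fin n) F) 0 0 ((A⁻¹ : GL (Fin n) F).1)ᵀ *
      fromBlocks 1 B 0 1}

/-- The matrix `σ_r⁺`, which for each of the first `r` indices `i` swaps the basis vectors
`e^i` and `e^{n+i}`, and fixes the other basis vectors:
`[0, 0, 1_r, 0; 0, 1_{n-r}, 0, 0; 1_r, 0, 0, 0; 0, 0, 0, 1_{n-r}]`. -/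
def sigma (n r : ℕ) (F : Type*) [Field F] : Matrix (Fin n ⊕ Fin n) (Fin n ⊕ Fin n) F :=
  fromBlocks
    (diagonal fun i : Fin n => if (i : ℕ) < r then 0 else 1)
    (diagonal fun i : Fin n => if (i : ℕ) < r then 1 else 0)
    (diagonal fun i : Fin n => if (i : ℕ) < r then 1 else 0)
    (diagonal fun i : Fin n => if (i : ℕ) < r then 0 else 1)

/-- The double coset `P⁺ σ_r⁺ P⁺` in `O⁺(2n, q)`. -/
def dc (n r : ℕ) (F : Type*) [Field F] : Set (Matrix (Fin n ⊕ Fin n) (Fin n ⊕ Fin n) F) :=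
  DoubleCoset.doubleCoset (sigma n r F) (parabolic n F) (parabolic n F)

/-- `DC₁^±(n, q) = P⁺ σ_{n-1}⁺ P⁺` (used for `n ≥ 1`): this is `DC₁⁺` for even `n` and
`DC₁⁻` for odd `n`. -/
def dcOne (n : ℕ) (F : Type*) [Field F] : Set (Matrix (Fin n ⊕ Fin n) (Fin n ⊕ Fin n) F) :=
  dc n (n - 1) F

/-- `DC₂^±(n, q) = P⁺ σ_{n-2}⁺ P⁺` (used for `n ≥ 2`): this is `DC₂⁺` for even `n` and
`DC₂⁻` for odd `n`. -/
def dcTwo (n : ℕ) (F : Type*) [Field F] : Set (Matrix (Fin n ⊕ Fin n) (Fin n ⊕ Fin n) F) :=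
  dc n (n - 2) F

/-- `N_S(β)`: the number of matrices in the set `S` whose trace is `β`. Over a finite field this
is the cardinality of a finite set. -/
noncomputable def traceCount {n : ℕ} {F : Type*} [Field F]
    (S : Set (Matrix (Fin n ⊕ Fin n) (Fin n ⊕ Fin n) F)) (β : F) : ℕ :=
  {w | w ∈ S ∧ trace w = β}.ncard

/-- The trace function `tr x = x + x² + ⋯ + x^(2^(r-1))` of the field with `2 ^ r` elements onto
its prime field; its values are regarded as elements `0`, `1` of the field itself. -/
def tr {F : Type*} [Field F] (r : ℕ) (x : F) : F :=
  ∑ i ∈ Finset.range r, x ^ (2 ^ i)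

end OrthogonalDoubleCoset

/-! In characteristic 2 every double coset with `s ≥ 1` and `n ≥ 2` already attains each trace on a
one-parameter family `p * sigma n s F` with `p` in `parabolic n F` (`exists_mem_dc_trace_eq`). This
settles all cases except `dcOne 1 F` and `dcTwo 2 F`, where `s = 0`, `sigma` is the identity and the
double coset is `parabolic n F` itself (`dc_zero`), with trace `tr A + tr A⁻¹`. For `n = 2` this
trace is `(1 + (det A)⁻¹) tr A`: arbitrary once some determinant differs from 0 and 1, identically
zero when `q = 2`. For `n = 1` one counts the solutions of `a + a⁻¹ = β`; for `β ≠ 0` this reduces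
to `y² + y = β⁻¹`, whose solvability is governed by the trace (`tr_eq_zero_iff`). -/

namespace OrthogonalDoubleCoset

open Matrix

/-! ### The parabolic subgroup and double cosets with `s ≥ 1`. -/

section Parabolic

variable {n : ℕ} {F : Type*} [Field F]

/-- The matrix `[A, 0; 0, ᵗA⁻¹] * [1, B; 0, 1]`. -/
def parabolicMk (A : GL (Fin n) F) (B : Matrix (Fin n) (Fin n) F) :
    Matrix (Fin n ⊕ Fin n) (Fin n ⊕ Fin n) F :=
  fromBlocks A ((A : Matrix (Fin n) (Fin n) F) * B) 0 ((A⁻¹ : GL (Fin n) F).1)ᵀ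

theorem mem_parabolic {w : Matrix (Fin n ⊕ Fin n) (Fin n ⊕ Fin n) F} :
    w ∈ parabolic n F ↔
      ∃ (A : GL (Fin n) F) (B : Matrix (Fin n) (Fin n) F), IsAlternating B ∧
        w = parabolicMk A B := by
  simp [parabolic, parabolicMk, fromBlocks_multiply]

theorem parabolicMk_mem (A : GL (Fin n) F) {B : Matrix (Fin n) (Fin n) F}
    (hB : IsAlternating B) : parabolicMk A B ∈ parabolic n F :=
  mem_parabolic.2 ⟨A, B, hB, rfl⟩

theorem isAlternating_zero : IsAlternating (0 : Matrix (Fin n) (Fin n) F) := by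
  simp [IsAlternating]

theorem IsAlternating.add {B C : Matrix (Fin n) (Fin n) F} (hB : IsAlternating B)
    (hC : IsAlternating C) : IsAlternating (B + C) := by
  refine ⟨fun i => by simp [hB.1 i, hC.1 i], fun i j => ?_⟩
  simp only [Matrix.add_apply, hB.2 i j, hC.2 i j]
  ring

theorem IsAlternating.transpose_eq {B : Matrix (Fin n) (Fin n) F} (hB : IsAlternating B) :
    Bᵀ = -B := by
  ext i j
  simpa using hB.2 j i

theorem IsAlternating.congruence {B : Matrix (Fin n) (Fin n) F} (hB : IsAlternating B)
    (M : Matrix (Fin n) (Fin n) F) : IsAlternating (M * B * Mᵀ) := by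
  constructor
  · intro i
    simp only [mul_apply, Finset.sum_mul, transpose_apply]
    rw [← Finset.sum_product']
    -- The terms at `(j, k)` and `(k, j)` cancel and those with `j = k` vanish, so no division by 2
    -- is needed.
    refine Finset.sum_involution (fun p _ => p.swap) ?_ ?_ (by simp) (by simp)
    · rintro ⟨j, k⟩ -
      simp only [Prod.fst_swap, Prod.snd_swap]
      rw [hB.2 j k]
      ring
    · rintro ⟨j, k⟩ - h he
      have hjk : k = j := (Prod.ext_iff.1 he).1
      subst hjk
      simp [hB.1] at h
  · intro i j
    have h : (M * B * Mᵀ)ᵀ = -(M * B * Mᵀ) := by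
      simp [transpose_mul, hB.transpose_eq, Matrix.mul_assoc]
    simpa using congrFun (congrFun h j) i

theorem parabolicMk_one_zero : parabolicMk (1 : GL (Fin n) F) 0 = 1 := by
  simp [parabolicMk, fromBlocks_one]

theorem one_mem_parabolic :
    (1 : Matrix (Fin n ⊕ Fin n) (Fin n ⊕ Fin n) F) ∈ parabolic n F :=
  parabolicMk_one_zero (n := n) (F := F) ▸ parabolicMk_mem 1 isAlternating_zero

theorem parabolicMk_mul (A C : GL (Fin n) F) (B D : Matrix (Fin n) (Fin n) F) :
    parabolicMk A B * parabolicMk C D =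
      parabolicMk (A * C) (D + (C⁻¹).1 * B * ((C⁻¹).1)ᵀ) := by
  have h : (C : Matrix (Fin n) (Fin n) F) * (C⁻¹).1 = 1 := C.mul_inv
  have h' : (A : Matrix (Fin n) (Fin n) F) * C * ((C⁻¹).1 * B * ((C⁻¹).1)ᵀ) =
      A * B * ((C⁻¹).1)ᵀ := by
    calc _ = A * (C * (C⁻¹).1) * B * ((C⁻¹).1)ᵀ := by simp only [Matrix.mul_assoc]
      _ = _ := by rw [h, Matrix.mul_one]
  simp only [parabolicMk, fromBlocks_multiply, Units.val_mul, _root_.mul_inv_rev,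
    Matrix.mul_add, h']
  simp [Matrix.mul_assoc]

theorem mul_mem_parabolic {v w : Matrix (Fin n ⊕ Fin n) (Fin n ⊕ Fin n) F}
    (hv : v ∈ parabolic n F) (hw : w ∈ parabolic n F) : v * w ∈ parabolic n F := by
  obtain ⟨A, B, hB, rfl⟩ := mem_parabolic.1 hv
  obtain ⟨C, D, hD, rfl⟩ := mem_parabolic.1 hw
  rw [parabolicMk_mul]
  exact parabolicMk_mem _ (hD.add (hB.congruence _))

theorem sigma_zero : sigma n 0 F = 1 := by
  simp [sigma]

theorem dc_zero : dc n 0 F = parabolic n F := by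
  ext w
  rw [dc, DoubleCoset.mem_doubleCoset, sigma_zero]
  constructor
  · rintro ⟨x, hx, y, hy, rfl⟩
    simpa using mul_mem_parabolic hx hy
  · exact fun hw => ⟨w, hw, 1, one_mem_parabolic, by simp⟩

theorem trace_blocks (A B C D : Matrix (Fin n) (Fin n) F) :
    trace (fromBlocks A B C D) = trace A + trace D := by
  simp [trace, Fintype.sum_sum_type]

theorem trace_parabolicMk (A : GL (Fin n) F) (B : Matrix (Fin n) (Fin n) F) :
    trace (parabolicMk A B) = trace A.1 + trace (A⁻¹).1 := by
  simp [parabolicMk, trace_blocks]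

theorem parabolicMk_injective :
    Function.Injective fun p : GL (Fin n) F × Matrix (Fin n) (Fin n) F =>
      parabolicMk p.1 p.2 := by
  rintro ⟨A, B⟩ ⟨C, D⟩ h
  obtain ⟨h₁, h₂, -, -⟩ := fromBlocks_inj.1 h
  obtain rfl : A = C := Units.ext h₁
  have h₃ := congrArg ((A⁻¹).1 * ·) h₂
  simp only [← Matrix.mul_assoc] at h₃
  rw [show (A⁻¹).1 * A.1 = 1 from A.inv_mul, Matrix.one_mul, Matrix.one_mul] at h₃
  rw [h₃]

theorem traceCount_pos [Finite F] {S : Set (Matrix (Fin n ⊕ Fin n) (Fin n ⊕ Fin n) F)} {β : F}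
    (h : ∃ w ∈ S, trace w = β) : 0 < traceCount S β :=
  (Set.ncard_pos (Set.toFinite _)).2 h

/-- The trace on `P⁺ σ_s⁺ P⁺` takes every value in characteristic two, when `s ≥ 1`, `n ≥ 2`. -/
theorem exists_mem_dc_trace_eq [CharP F 2] (hn : 2 ≤ n) {s : ℕ} (hs : 0 < s) (β : F) :
    ∃ w ∈ dc n s F, trace w = β := by
  let i : Fin n := ⟨0, by omega⟩
  let j : Fin n := ⟨1, by omega⟩
  have hij : i ≠ j := by simp [i, j]
  let A : GL (Fin n) F := ⟨transvection i j β, transvection i j (-β),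
    by simp [transvection_mul_transvection_same i j hij],
    by simp [transvection_mul_transvection_same i j hij]⟩
  -- Chosen so that `A * B` is `B` plus `β` at the diagonal place `i = 0`, a place that the
  -- off-diagonal block of `sigma` selects because `0 < s`.
  let B : Matrix (Fin n) (Fin n) F := single j i 1 - single i j 1
  have hB : IsAlternating B := by
    refine ⟨fun k => ?_, fun k l => ?_⟩
    · simp only [B, Matrix.sub_apply, single_apply, and_comm, sub_self]
    · simp only [B, Matrix.sub_apply, single_apply, and_comm, neg_sub]
  refine ⟨_, DoubleCoset.mem_doubleCoset.2
    ⟨parabolicMk A B, parabolicMk_mem A hB, 1, one_mem_parabolic, rfl⟩, ?_⟩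
  have hAB : A.1 * B = B + single i i β := by
    simp [A, B, transvection, add_mul, mul_sub, single_mul_single_of_ne _ _ _ _ hij.symm]
    abel
  have hd (k l : Fin n) (c : F) (d : Fin n → F) :
      trace (single k l c * diagonal d) = if k = l then c * d k else 0 := by
    rw [trace_single_mul]
    simp [diagonal_apply, eq_comm]
    split_ifs with h <;> simp [h]
  have h2 : ∀ x : F, x + x = 0 := CharTwo.add_self_eq_zero
  simp only [parabolicMk, sigma, fromBlocks_multiply, Matrix.mul_one, trace_blocks, hAB,
    zero_mul, zero_add, trace_add]
  simp [A, B, transvection, add_mul, sub_mul, hd, hij, hij.symm, i, hs]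
  -- The basis vectors fixed by `sigma` contribute equally to both diagonal blocks, hence cancel in
  -- characteristic 2.
  rw [add_right_comm, h2, zero_add]

end Parabolic

/-! ### The case `n = 2`, `s = 0`. -/

section GeneralLinearTwo

variable {F : Type*} [Field F]

theorem trace_inv_fin_two (A : GL (Fin 2) F) :
    trace (A⁻¹).1 = (det A.1)⁻¹ * trace A.1 := by
  rw [coe_units_inv, inv_def, trace_smul, adjugate_fin_two]
  simp [trace_fin_two, add_comm]

theorem exists_mem_parabolic_two_trace_eq [CharP F 2] {δ : F} (h0 : δ ≠ 0) (h1 : δ ≠ 1) (β : F) :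
    ∃ w ∈ parabolic 2 F, trace w = β := by
  -- A companion matrix of determinant `δ` whose trace makes `(1 + δ⁻¹) tr A` equal to `β`.
  let A : GL (Fin 2) F := GeneralLinearGroup.mkOfDetNeZero !![0, -δ; 1, β / (1 + δ⁻¹)]
    (by simpa [det_fin_two])
  have h' : 1 + δ ≠ 0 := by
    rw [← CharTwo.sub_eq_add, sub_ne_zero]
    exact h1.symm
  refine ⟨_, parabolicMk_mem A isAlternating_zero, ?_⟩
  rw [trace_parabolicMk, trace_inv_fin_two]
  have hA : A.1 = !![0, -δ; 1, β / (1 + δ⁻¹)] := rfl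
  simp only [hA, det_fin_two_of, trace_fin_two_of]
  rw [show 1 + δ⁻¹ = (1 + δ) / δ by field_simp; ring]
  simp only [div_div_eq_mul_div, zero_mul, zero_sub, mul_one, neg_neg, zero_add]
  field_simp
  ring

theorem isAlternating_fin_two {B : Matrix (Fin 2) (Fin 2) F} :
    IsAlternating B ↔ ∃ b, !![0, b; -b, 0] = B := by
  constructor
  · intro h
    refine ⟨B 0 1, ?_⟩
    ext i j
    fin_cases i <;> fin_cases j <;> simp [h.1, ← h.2 1 0]
  · rintro ⟨b, rfl⟩
    simp [IsAlternating, Fin.forall_fin_two]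

theorem ncard_parabolic_two [Fintype F] (hF : Fintype.card F = 2) :
    (parabolic 2 F).ncard = 12 := by
  have h : parabolic 2 F = Set.range
      ((fun p : GL (Fin 2) F × Matrix (Fin 2) (Fin 2) F => parabolicMk p.1 p.2) ∘
        Prod.map id (fun b : F => !![0, b; -b, 0])) := by
    ext w
    simp only [mem_parabolic, isAlternating_fin_two, Set.mem_range, Prod.exists,
      Function.comp_apply, Prod.map_apply, id]
    constructor
    · rintro ⟨A, _, ⟨b, rfl⟩, rfl⟩
      exact ⟨A, b, rfl⟩
    · rintro ⟨A, b, rfl⟩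
      exact ⟨A, _, ⟨b, rfl⟩, rfl⟩
  have hb : Function.Injective fun b : F => !![0, b; -b, 0] := fun b c hbc => by
    simpa using congrFun (congrFun hbc 0) 1
  rw [h, ← Nat.card_coe_set_eq,
    Nat.card_range_of_injective (parabolicMk_injective.comp (Function.injective_id.prodMap hb)),
    Nat.card_prod, card_GL_field, Nat.card_eq_fintype_card, hF]
  simp [Fin.prod_univ_two]

theorem trace_eq_zero_of_mem_parabolic_two [Fintype F] [CharP F 2] (hF : Fintype.card F = 2)
    {w : Matrix (Fin 2 ⊕ Fin 2) (Fin 2 ⊕ Fin 2) F} (hw : w ∈ parabolic 2 F) : trace w = 0 := by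
  obtain ⟨A, B, -, rfl⟩ := mem_parabolic.1 hw
  have hdet : det A.1 = 1 := by
    have := FiniteField.pow_card_sub_one_eq_one (det A.1) (GeneralLinearGroup.det A).ne_zero
    simpa [hF] using this
  rw [trace_parabolicMk, trace_inv_fin_two, hdet, inv_one, one_mul, CharTwo.add_self_eq_zero]

end GeneralLinearTwo

/-! ### Kernel of the trace as the image of `y ↦ y² + y`. -/

section ArtinSchreier

open Polynomial in
-- The zeros are roots of a polynomial of degree at most `2 ^ r`, nonzero because its coefficient at
-- `X` is 1.
theorem card_tr_eq_zero_le {F : Type*} [Field F] [Fintype F] [DecidableEq F] (r : ℕ) :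
    (Finset.univ.filter fun x : F => tr (r + 1) x = 0).card ≤ 2 ^ r := by
  let p : F[X] := ∑ i ∈ Finset.range (r + 1), X ^ 2 ^ i
  have hdeg : p.natDegree ≤ 2 ^ r := natDegree_sum_le_of_forall_le _ _ fun i hi => by
    rw [natDegree_X_pow]
    exact Nat.pow_le_pow_right two_pos (Nat.lt_succ_iff.1 (Finset.mem_range.1 hi))
  have hp : p ≠ 0 := fun h => by
    have h1 : p.coeff 1 = 1 := by
      simp only [p, finsetSum_coeff, coeff_X_pow]
      rw [Finset.sum_eq_single 0]
      · simp
      · intro i _ hi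
        have := Nat.one_lt_two_pow hi
        simp [this.ne]
      · simp
    simp [h] at h1
  calc _ ≤ p.roots.toFinset.card := Finset.card_le_card fun x hx => by
        have hx : tr (r + 1) x = 0 := (Finset.mem_filter.1 hx).2
        simpa [hp, p, eval_finsetSum, tr] using hx
    _ ≤ p.roots.card := Multiset.toFinset_card_le _
    _ ≤ 2 ^ r := (card_roots' p).trans hdeg

variable {F : Type*} [Field F] [CharP F 2]

theorem tr_add (r : ℕ) (x y : F) : tr r (x + y) = tr r x + tr r y := by
  simp [tr, add_pow_char_pow, Finset.sum_add_distrib]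

theorem tr_sq (r : ℕ) (x : F) : tr r (x ^ 2) = tr r x + x + x ^ 2 ^ r := by
  have h : tr r (x ^ 2) + x = tr r x + x ^ 2 ^ r := by
    simp only [tr, ← pow_mul, ← pow_succ']
    rw [← Finset.sum_range_succ, Finset.sum_range_succ']
    simp
  linear_combination h - x * CharTwo.two_eq_zero (R := F)

variable [Fintype F]

theorem tr_sq_add_self {r : ℕ} (hq : Fintype.card F = 2 ^ r) (x : F) : tr r (x ^ 2 + x) = 0 := by
  rw [tr_add, tr_sq, ← hq, FiniteField.pow_card]
  linear_combination CharTwo.add_self_eq_zero (tr r x) + CharTwo.add_self_eq_zero x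

/-- The image of `y ↦ y² + y` lies in the kernel of `tr`. Its fibres have at most two elements, so
it has at least `q / 2` elements, while the kernel has at most `q / 2`; hence they coincide. -/
theorem tr_eq_zero_iff {r : ℕ} (hr : 0 < r) (hq : Fintype.card F = 2 ^ r) (x : F) :
    tr r x = 0 ↔ ∃ y, y ^ 2 + y = x := by
  classical
  refine ⟨fun hx => ?_, by rintro ⟨y, rfl⟩; exact tr_sq_add_self hq y⟩
  obtain ⟨r, rfl⟩ := Nat.exists_eq_succ_of_ne_zero hr.ne'
  have hsub : Finset.univ.image (fun y : F => y ^ 2 + y) ⊆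
      Finset.univ.filter fun x : F => tr (r + 1) x = 0 := by
    intro z hz
    obtain ⟨y, -, rfl⟩ := Finset.mem_image.1 hz
    simpa using tr_sq_add_self hq y
  have hcard : (Finset.univ : Finset F).card ≤
      2 * (Finset.univ.image fun y : F => y ^ 2 + y).card := by
    refine Finset.card_le_mul_card_image _ _ fun b hb => ?_
    obtain ⟨y, -, rfl⟩ := Finset.mem_image.1 hb
    refine (Finset.card_le_card (t := {y, y + 1}) fun z hz => ?_).trans Finset.card_le_two
    have hz : z ^ 2 + z = y ^ 2 + y := by simpa using hz
    have h : (z - y) * (z - (y + 1)) = 0 := by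
      linear_combination hz - (z * y + z - y ^ 2 - y) * CharTwo.two_eq_zero (R := F)
    simpa [sub_eq_zero] using h
  have himage := Finset.eq_of_subset_of_card_le hsub (by
    have := card_tr_eq_zero_le (F := F) r
    rw [Finset.card_univ, hq, Nat.succ_eq_add_one, pow_succ] at hcard
    omega)
  have : x ∈ Finset.univ.image (fun y : F => y ^ 2 + y) := by
    rw [himage]
    simpa using hx
  simpa using this

end ArtinSchreier

/-! ### The case `n = 1`, `s = 0`. -/

section RankOne

variable {F : Type*} [Field F]

theorem traceCount_parabolic_one (β : F) :
    traceCount (parabolic 1 F) β = {a : F | a ≠ 0 ∧ a + a⁻¹ = β}.ncard := by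
  have h : {w | w ∈ parabolic 1 F ∧ trace w = β} =
      (fun a : F => fromBlocks (diagonal fun _ : Fin 1 => a) 0 0 (diagonal fun _ : Fin 1 => a⁻¹)) ''
        {a : F | a ≠ 0 ∧ a + a⁻¹ = β} := by
    ext w
    constructor
    · rintro ⟨hw, ht⟩
      obtain ⟨A, B, hB, rfl⟩ := mem_parabolic.1 hw
      have hB0 : B = 0 := by
        ext i j
        rw [Subsingleton.elim j i]
        exact hB.1 i
      have hmul : A.1 0 0 * (A⁻¹).1 0 0 = 1 := by
        simpa [mul_apply] using congrFun (congrFun A.mul_inv 0) 0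
      have hinv : (A⁻¹).1 0 0 = (A.1 0 0)⁻¹ := eq_inv_of_mul_eq_one_right hmul
      refine ⟨A.1 0 0, ⟨left_ne_zero_of_mul_eq_one hmul, ?_⟩, ?_⟩
      · rw [← hinv, ← ht, trace_parabolicMk]
        simp only [trace_fin_one]
      · have hdiag (M : Matrix (Fin 1) (Fin 1) F) : (diagonal fun _ => M 0 0) = M := by
          ext i j
          rw [Subsingleton.elim i 0, Subsingleton.elim j 0, diagonal_apply_eq]
        simp only [parabolicMk, hB0, Matrix.mul_zero, ← hinv, hdiag]
        rw [← hdiag ((A⁻¹).1)ᵀ, transpose_apply, hdiag]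
    · rintro ⟨a, ⟨h0, ha⟩, rfl⟩
      let A : GL (Fin 1) F := ⟨diagonal fun _ => a, diagonal fun _ => a⁻¹,
        by simp [h0], by simp [h0]⟩
      refine ⟨mem_parabolic.2 ⟨A, 0, isAlternating_zero, ?_⟩, ?_⟩
      · simp only [parabolicMk, Matrix.mul_zero]
        exact congrArg (fromBlocks _ 0 0) (diagonal_transpose _).symm
      · simpa [trace_blocks] using ha
  rw [traceCount, h, Set.ncard_image_of_injective]
  intro a b hab
  simpa using congrFun (congrFun (fromBlocks_inj.1 hab).1 0) 0

variable [CharP F 2]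

theorem ncard_add_inv_eq_zero : {a : F | a ≠ 0 ∧ a + a⁻¹ = 0}.ncard = 1 := by
  rw [Set.ncard_eq_one]
  refine ⟨1, Set.ext fun a => ⟨fun ⟨h0, h⟩ => ?_, ?_⟩⟩
  · rw [CharTwo.add_eq_zero] at h
    have : a ^ 2 = 1 ^ 2 := by
      rw [pow_two]
      nth_rw 1 [h]
      simp [h0]
    exact CharTwo.sq_inj.1 this
  · rintro rfl
    simp [CharTwo.add_self_eq_zero]

/-- The equation is `a² + βa + 1 = 0`. Putting `a = βy` gives `y² + y = β⁻²`, which is solved by `y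
= z²` and `y = z² + 1`. -/
theorem ncard_add_inv_eq_two {β z : F} (hβ : β ≠ 0) (hz : z ^ 2 + z = β⁻¹) :
    {a : F | a ≠ 0 ∧ a + a⁻¹ = β}.ncard = 2 := by
  have h2 := CharTwo.two_eq_zero (R := F)
  have hz' : β * z ^ 2 + β * z = 1 := by
    rw [← mul_add, hz, mul_inv_cancel₀ hβ]
  have hne : β * z ^ 2 ≠ β * z ^ 2 + β := by simpa
  have hprod : (β * z ^ 2) * (β * z ^ 2 + β) = 1 := by
    linear_combination (β * z ^ 2 + β * z + 1) * hz' - β ^ 2 * z ^ 3 * h2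
  rw [← Set.ncard_pair hne]
  congr 1
  ext a
  have key : a ≠ 0 ∧ a + a⁻¹ = β ↔ (a - β * z ^ 2) * (a - (β * z ^ 2 + β)) = 0 := by
    have e : (a - β * z ^ 2) * (a - (β * z ^ 2 + β)) = a ^ 2 + 1 - β * a := by
      linear_combination hprod - a * β * z ^ 2 * h2
    rw [e]
    constructor
    · rintro ⟨h0, rfl⟩
      field_simp
      ring
    · intro h
      have h0 : a ≠ 0 := by
        rintro rfl
        simp at h
      refine ⟨h0, ?_⟩
      field_simp
      linear_combination h
  rw [Set.mem_ofPred_eq, key, mul_eq_zero, sub_eq_zero, sub_eq_zero]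
  rfl

theorem exists_of_add_inv_eq {a β : F} (hβ : β ≠ 0) (h0 : a ≠ 0) (h : a + a⁻¹ = β) :
    ∃ y, y ^ 2 + y = β⁻¹ := by
  have h' : a ^ 2 + 1 = β * a := by
    rw [← h]
    field_simp
  -- `a / β` would give `β⁻²`; the shift by `β⁻¹` turns this into `β⁻¹`.
  refine ⟨(a + 1) / β, ?_⟩
  field_simp
  linear_combination h' + (a + β * a) * CharTwo.two_eq_zero (R := F)

end RankOne

end OrthogonalDoubleCoset

/-! ### Assembly of the cases. -/

open OrthogonalDoubleCoset in
theorem corollary10 {F : Type*} [Field F] [Fintype F] (r : ℕ) (hr : 0 < r)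
    (hq : Fintype.card F = 2 ^ r) :
    -- (a)
    (∀ n : ℕ, 2 ≤ n → Even n →
      ∀ β : F, 0 < OrthogonalDoubleCoset.traceCount (OrthogonalDoubleCoset.dcOne n F) β) ∧
    -- (b)
    ((∀ n : ℕ, Even n → (4 ≤ n ∨ (n = 2 ∧ 4 ≤ Fintype.card F)) →
      ∀ β : F, 0 < OrthogonalDoubleCoset.traceCount (OrthogonalDoubleCoset.dcTwo n F) β) ∧
     (Fintype.card F = 2 →
      OrthogonalDoubleCoset.traceCount (OrthogonalDoubleCoset.dcTwo 2 F) 1 = 0 ∧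
      OrthogonalDoubleCoset.traceCount (OrthogonalDoubleCoset.dcTwo 2 F) 0 = 12 ∧
      (OrthogonalDoubleCoset.parabolic 2 F).ncard = 12)) ∧
    -- (c)
    ((∀ n : ℕ, 3 ≤ n → Odd n →
      ∀ β : F, 0 < OrthogonalDoubleCoset.traceCount (OrthogonalDoubleCoset.dcOne n F) β) ∧
     (OrthogonalDoubleCoset.traceCount (OrthogonalDoubleCoset.dcOne 1 F) 0 = 1 ∧
      (∀ β : F, β ≠ 0 → OrthogonalDoubleCoset.tr r β⁻¹ = 0 →
        OrthogonalDoubleCoset.traceCount (OrthogonalDoubleCoset.dcOne 1 F) β = 2) ∧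
      (∀ β : F, β ≠ 0 → OrthogonalDoubleCoset.tr r β⁻¹ = 1 →
        OrthogonalDoubleCoset.traceCount (OrthogonalDoubleCoset.dcOne 1 F) β = 0))) ∧
    -- (d)
    (∀ n : ℕ, 3 ≤ n → Odd n →
      ∀ β : F, 0 < OrthogonalDoubleCoset.traceCount (OrthogonalDoubleCoset.dcTwo n F) β) := by
  have : Fact (Nat.Prime 2) := ⟨Nat.prime_two⟩
  have : CharP F 2 := charP_of_card_eq_prime_pow hq
  have hone (n : ℕ) (hn : 2 ≤ n) (β : F) : 0 < traceCount (dcOne n F) β :=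
    traceCount_pos (exists_mem_dc_trace_eq hn (by omega) β)
  have htwo (n : ℕ) (hn : 3 ≤ n) (β : F) : 0 < traceCount (dcTwo n F) β :=
    traceCount_pos (exists_mem_dc_trace_eq (by omega) (by omega) β)
  have hdcOne : dcOne 1 F = parabolic 1 F := dc_zero
  have hdcTwo : dcTwo 2 F = parabolic 2 F := dc_zero
  refine ⟨fun n hn _ => hone n hn, ⟨?_, ?_⟩, ⟨fun n hn _ => hone n (by omega), ?_, ?_, ?_⟩,
    fun n hn _ => htwo n hn⟩
  · rintro n - (hn | ⟨rfl, hF⟩) β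
    · exact htwo n (by omega) β
    · classical
      obtain ⟨δ, -, hδ⟩ := Finset.exists_mem_notMem_of_card_lt_card
        (s := {0, 1}) (t := (Finset.univ : Finset F))
        (Finset.card_le_two.trans_lt (by rw [Finset.card_univ]; omega))
      simp only [Finset.mem_insert, Finset.mem_singleton, not_or] at hδ
      rw [hdcTwo]
      exact traceCount_pos (exists_mem_parabolic_two_trace_eq hδ.1 hδ.2 β)
  · intro hF
    rw [hdcTwo]
    refine ⟨?_, ?_, ncard_parabolic_two hF⟩
    · rw [traceCount, Set.ncard_eq_zero (Set.toFinite _), Set.eq_empty_iff_forall_notMem]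
      rintro w ⟨hw, h1⟩
      exact zero_ne_one ((trace_eq_zero_of_mem_parabolic_two hF hw).symm.trans h1)
    · rw [← ncard_parabolic_two hF, traceCount]
      congr 1
      ext w
      exact and_iff_left_of_imp (trace_eq_zero_of_mem_parabolic_two hF)
  · rw [hdcOne, traceCount_parabolic_one, ncard_add_inv_eq_zero]
  · intro β hβ h
    obtain ⟨z, hz⟩ := (tr_eq_zero_iff hr hq _).1 h
    rw [hdcOne, traceCount_parabolic_one, ncard_add_inv_eq_two hβ hz]
  · intro β hβ h
    rw [hdcOne, traceCount_parabolic_one, Set.ncard_eq_zero (Set.toFinite _),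
      Set.eq_empty_iff_forall_notMem]
    rintro a ⟨h0, ha⟩
    have := (tr_eq_zero_iff hr hq _).2 (exists_of_add_inv_eq hβ h0 ha)
    exact zero_ne_one (this.symm.trans h)
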